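/- Let $n\ge 1$ and let $\mathcal H:\mathbb S^n\to\mathbb R$ be a $C^1$ function on the unit sphere $\mathbb S^n\subset\mathbb R^{n+1}$ such that $\mathcal H(x_0)=0$ for some $x_0\in\mathbb S^n$. Then there is no compact $\mathcal H$-hypersurface in $\mathbb R^{n+1}$. Here a compact $\mathcal H$-hypersurface is a $C^2$ immersion $\psi:\Sigma\to\mathbb R^{n+1}$ of a non-empty compact $n$-dimensional manifold $\Sigma$ without boundary, oriented by a $C^1$ unit normal field (Gauss map) $\eta:\Sigma\to\mathbb S^n$, such that $$H_\Sigma(p)=\mathcal H(\eta(p))\qquad\text{for all } p\in\Sigma,$$ where $H_\Sigma=\frac1n\operatorname{tr}(S)$ is the mean curvature of $\psi$ with respect to $\eta$, and $S$ is the shape operator, determined by $d\psi_p(S_p v)=-d\eta_p(v)$ for $v\in T_p\Sigma$ (so the unit sphere with its inner unit normal has mean curvature $1$). -/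

import Mathlib

open scoped Manifold ContDiff

noncomputable section

/-- The shape operator `S = -dη` at `p` of an immersion `ψ : M → ℝⁿ⁺¹` with unit normal `η`, as an
endomorphism of the tangent space `T_p M`: it is characterized by `dψ_p (S v) = -dη_p v`. Since
`dη_p` takes values in the image of the injective map `dψ_p`, the choice of the left inverse of
`dψ_p` outside this image is irrelevant. -/
def shapeOperator {n : ℕ} {M : Type*} [TopologicalSpace M]
    [ChartedSpace (EuclideanSpace ℝ (Fin n)) M]
    (ψ : M → EuclideanSpace ℝ (Fin (n + 1)))
    (η : M → Metric.sphere (0 : EuclideanSpace ℝ (Fin (n + 1))) 1) (p : M) :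
    TangentSpace (𝓡 n) p →ₗ[ℝ] TangentSpace (𝓡 n) p :=
  -((mvfderiv (𝓡 n) ψ p).toLinearMap.leftInverse ∘ₗ
    (mvfderiv (𝓡 n) (fun q => (η q : EuclideanSpace ℝ (Fin (n + 1)))) p).toLinearMap)

/-- The mean curvature `H_Σ = (κ₁ + ⋯ + κₙ) / n`, normalized so that the unit sphere with its inner
unit normal has mean curvature `1`. -/
def meanCurvature {n : ℕ} {M : Type*} [TopologicalSpace M]
    [ChartedSpace (EuclideanSpace ℝ (Fin n)) M]
    (ψ : M → EuclideanSpace ℝ (Fin (n + 1)))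
    (η : M → Metric.sphere (0 : EuclideanSpace ℝ (Fin (n + 1))) 1) (p : M) : ℝ :=
  LinearMap.trace ℝ (TangentSpace (𝓡 n) p) (shapeOperator ψ η p) / n

/-- `ψ : M → ℝⁿ⁺¹` is an immersed hypersurface of class `C²`, oriented by the unit normal (Gauss
map) `η : M → 𝕊ⁿ`. (A continuous unit normal of a `C²` immersion is automatically `C¹`.) -/
structure IsOrientedHypersurface {n : ℕ} {M : Type*} [TopologicalSpace M]
    [ChartedSpace (EuclideanSpace ℝ (Fin n)) M]
    (ψ : M → EuclideanSpace ℝ (Fin (n + 1)))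
    (η : M → Metric.sphere (0 : EuclideanSpace ℝ (Fin (n + 1))) 1) : Prop where
  contMDiff : ContMDiff (𝓡 n) 𝓘(ℝ, EuclideanSpace ℝ (Fin (n + 1))) 2 ψ
  injective_mvfderiv : ∀ p : M, Function.Injective (mvfderiv (𝓡 n) ψ p)
  contMDiff_normal : ContMDiff (𝓡 n) 𝓘(ℝ, EuclideanSpace ℝ (Fin (n + 1))) 1
    (fun q => (η q : EuclideanSpace ℝ (Fin (n + 1))))
  normal_orthogonal : ∀ (p : M) (v : TangentSpace (𝓡 n) p),
    inner ℝ (mvfderiv (𝓡 n) ψ p v) (η p : EuclideanSpace ℝ (Fin (n + 1))) = 0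

/-- `ψ : M → ℝⁿ⁺¹`, oriented by its Gauss map `η`, is a hypersurface of prescribed mean curvature
`𝓗` (an `𝓗`-hypersurface): `H_Σ = 𝓗 ∘ η`. -/
structure IsPrescribedMeanCurvatureHypersurface {n : ℕ} {M : Type*} [TopologicalSpace M]
    [ChartedSpace (EuclideanSpace ℝ (Fin n)) M]
    (𝓗 : Metric.sphere (0 : EuclideanSpace ℝ (Fin (n + 1))) 1 → ℝ)
    (ψ : M → EuclideanSpace ℝ (Fin (n + 1)))
    (η : M → Metric.sphere (0 : EuclideanSpace ℝ (Fin (n + 1))) 1) : Prop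
    extends IsOrientedHypersurface ψ η where
  meanCurvature_eq : meanCurvature ψ η = 𝓗 ∘ η

end

/-! Let `𝓗 a = 0`. Hyperplanes with normal `a` have mean curvature `0 = 𝓗 a`, so they are barriers
for an `𝓗`-hypersurface. By compactness the height `⟨a, ψ⟩` attains a maximum and a minimum, and
there the normal is `a` or `-a`.

If the normal is `a` at one of these points, the strong maximum principle makes the height locally
constant (`eventually_height_eq_of_isLocalExtr`). The points of that extreme height with normal `a`
then form a non-empty open and compact set. A coordinate orthogonal to `a` has a maximum on it,
where the normal would have to be parallel to that coordinate direction, which is absurd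
(`false_of_isExtrOn_of_normal_eq`). Connectedness of `M` plays no role.

Otherwise the normal is `-a` at both extrema. Comparing second derivatives there gives `𝓗 (-a) ≥ 0`
at the maximum and `𝓗 (-a) ≤ 0` at the minimum, so `𝓗 (-a) = 0`, and the first case applies to `-a`.

The maximum principle needs an inequality `|Lu| ≤ C ‖du‖` for the height `u`, where `L` is the trace
of the Hessian in a frame orthonormal for the induced metric. It holds because `𝓗` is `O(‖η - a‖)`
near `a`, and `‖η - a‖` is controlled by the tangential part of `a`, which is the gradient of `u`
(`abs_sum_inner_le_of_abs_sum_inner_normal_le`). -/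

open Filter Topology Metric Module

/-! ### Hopf's strong maximum principle -/

section MaximumPrinciple

variable {E : Type*} [NormedAddCommGroup E]

/-- The barrier function of Hopf's lemma. -/
noncomputable def hopfBarrier (α : ℝ) (y x : E) : ℝ := Real.exp (-α * ‖x - y‖ ^ 2)

theorem hopfBarrier_le_one {α : ℝ} (hα : 0 ≤ α) (y x : E) : hopfBarrier α y x ≤ 1 := by
  have : 0 ≤ α * ‖x - y‖ ^ 2 := by positivity
  exact Real.exp_le_one_iff.2 (by linarith)

theorem hopfBarrier_lt {α : ℝ} (hα : 0 < α) {y x z : E} (h : dist z y < dist x y) :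
    hopfBarrier α y x < hopfBarrier α y z := by
  have h1 : dist z y ^ 2 < dist x y ^ 2 := by gcongr
  have h2 := mul_lt_mul_of_pos_left h1 hα
  refine Real.exp_lt_exp.2 ?_
  rw [← dist_eq_norm, ← dist_eq_norm]
  linarith

variable [InnerProductSpace ℝ E]

theorem hasDerivAt_add_smul_const (x v : E) (t : ℝ) :
    HasDerivAt (fun t : ℝ => x + t • v) v t := by
  simpa using ((hasDerivAt_id t).smul_const v).const_add x

theorem tendsto_add_smul_zero (x v : E) : Tendsto (fun t : ℝ => x + t • v) (𝓝 0) (𝓝 x) := by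
  simpa using (hasDerivAt_add_smul_const x v 0).continuousAt.tendsto

theorem ContDiffAt.eventually_deriv_comp_line {f : E → ℝ} {x : E} (hf : ContDiffAt ℝ 2 f x)
    (v : E) :
    deriv (fun t : ℝ => f (x + t • v)) =ᶠ[𝓝 0] fun t => fderiv ℝ f (x + t • v) v := by
  filter_upwards [(tendsto_add_smul_zero x v).eventually (hf.eventually (by simp))] with t ht
  exact ((ht.differentiableAt (by simp)).hasFDerivAt.comp_hasDerivAt t
    (hasDerivAt_add_smul_const x v t)).deriv

theorem ContDiffAt.deriv_deriv_comp_line {f : E → ℝ} {x : E} (hf : ContDiffAt ℝ 2 f x) (v : E) :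
    deriv (deriv fun t : ℝ => f (x + t • v)) 0 = fderiv ℝ (fderiv ℝ f) x v v := by
  rw [(hf.eventually_deriv_comp_line v).deriv_eq]
  have h1 : DifferentiableAt ℝ (fderiv ℝ f) (x + (0 : ℝ) • v) := by
    rw [zero_smul, add_zero]
    exact (hf.fderiv_right (m := 1) (by norm_num)).differentiableAt (by simp)
  have h2 : HasDerivAt (fun t : ℝ => fderiv ℝ f (x + t • v))
      (fderiv ℝ (fderiv ℝ f) (x + (0 : ℝ) • v) v) 0 :=
    h1.hasFDerivAt.comp_hasDerivAt (0 : ℝ) (hasDerivAt_add_smul_const x v 0)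
  have h3 : HasDerivAt (fun t : ℝ => fderiv ℝ f (x + t • v) v)
      (fderiv ℝ (fderiv ℝ f) (x + (0 : ℝ) • v) v v) 0 :=
    (ContinuousLinearMap.apply ℝ ℝ v).hasFDerivAt.comp_hasDerivAt (0 : ℝ) h2
  rw [h3.deriv, zero_smul, add_zero]

theorem IsLocalMax.fderiv_fderiv_apply_self_nonpos {f : E → ℝ} {x : E}
    (hmax : IsLocalMax f x) (hf : ContDiffAt ℝ 2 f x) (v : E) :
    fderiv ℝ (fderiv ℝ f) x v v ≤ 0 := by
  have h1 : deriv (fun t : ℝ => f (x + t • v)) 0 = fderiv ℝ f x v := by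
    simpa using (hf.eventually_deriv_comp_line v).self_of_nhds
  have h2 := hf.deriv_deriv_comp_line v
  by_contra! hpos
  have hcont := tendsto_add_smul_zero x v
  -- A positive second derivative would make `0` also a local minimum along the line; then `f` is
  -- constant there and its second derivative vanishes.
  have hmin := isLocalMin_of_deriv_deriv_pos (f := fun t : ℝ => f (x + t • v)) (x₀ := 0)
    (by rw [h2]; exact hpos) (by rw [h1, hmax.fderiv_eq_zero]; simp)
    (by
      have h3 := hf.continuousAt.tendsto.comp hcont
      simpa [ContinuousAt, Function.comp_def] using h3)
  have hconst : (fun t : ℝ => f (x + t • v)) =ᶠ[𝓝 0] fun _ => f x := by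
    filter_upwards [hmin, hcont.eventually hmax] with t ht1 ht2
    simp only [zero_smul, add_zero] at ht1
    exact le_antisymm ht2 ht1
  have h4 : deriv (fun t : ℝ => f (x + t • v)) =ᶠ[𝓝 0] fun _ => 0 := by
    filter_upwards [hconst.eventuallyEq_nhds] with t ht
    rw [ht.deriv_eq]; simp
  rw [h4.deriv_eq] at h2
  simp only [deriv_const] at h2
  linarith

theorem contDiff_hopfBarrier (α : ℝ) (y : E) : ContDiff ℝ 2 (hopfBarrier α y) := by
  unfold hopfBarrier
  exact Real.contDiff_exp.comp
    (contDiff_const.mul ((contDiff_norm_sq ℝ).comp (contDiff_id.sub contDiff_const)))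

theorem hasFDerivAt_hopfBarrier (α : ℝ) (y x : E) :
    HasFDerivAt (hopfBarrier α y) ((-2 * α * hopfBarrier α y x) • innerSL ℝ (x - y)) x := by
  have h1 : HasFDerivAt (fun x : E => ‖x - y‖ ^ 2) (2 • innerSL ℝ (x - y)) x := by
    simpa using ((hasFDerivAt_id x).sub_const y).norm_sq
  have h2 := (h1.const_mul (-α)).exp
  refine h2.congr_fderiv ?_
  ext w
  simp [hopfBarrier]
  ring

theorem norm_fderiv_hopfBarrier_le {α : ℝ} (hα : 0 ≤ α) (y x : E) :
    ‖fderiv ℝ (hopfBarrier α y) x‖ ≤ 2 * α * hopfBarrier α y x * ‖x - y‖ := by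
  rw [(hasFDerivAt_hopfBarrier α y x).fderiv, norm_smul, innerSL_apply_norm]
  have : 0 < hopfBarrier α y x := Real.exp_pos _
  rw [Real.norm_eq_abs, show -2 * α * hopfBarrier α y x = -(2 * α * hopfBarrier α y x) by ring,
    abs_neg, abs_of_nonneg (by positivity)]

theorem fderiv_fderiv_hopfBarrier (α : ℝ) (y x v : E) :
    fderiv ℝ (fderiv ℝ (hopfBarrier α y)) x v v =
      hopfBarrier α y x * (4 * α ^ 2 * inner ℝ (x - y) v ^ 2 - 2 * α * ‖v‖ ^ 2) := by
  have h0 : fderiv ℝ (hopfBarrier α y) =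
      fun x => (-2 * α * hopfBarrier α y x) • innerSL ℝ (x - y) := by
    ext1 z
    exact (hasFDerivAt_hopfBarrier α y z).fderiv
  have h1 : HasFDerivAt (fun x : E => innerSL ℝ (x - y)) (innerSL ℝ (E := E)) x := by
    have := (innerSL ℝ (E := E)).hasFDerivAt.comp x ((hasFDerivAt_id x).sub_const y)
    rwa [ContinuousLinearMap.comp_id] at this
  have h2 := ((hasFDerivAt_hopfBarrier α y x).const_mul (-2 * α)).fun_smul h1
  rw [h0, h2.fderiv]
  have h3 : innerSL ℝ v v = ‖v‖ ^ 2 := real_inner_self_eq_norm_sq v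
  simp only [add_apply, smul_apply,
    ContinuousLinearMap.smulRight_apply, smul_eq_mul, innerSL_apply_apply, h3]
  ring

/-- The barrier is a strict subsolution of a uniformly elliptic operator away from its centre. -/
theorem lt_sum_fderiv_fderiv_hopfBarrier {ι : Type*} [Fintype ι] {e : ι → E} {l L C R α : ℝ}
    {y x : E} (hl : 0 < l) (hL : 0 ≤ L) (hC : 0 ≤ C) (hR : 0 < R)
    (hα : α = (Fintype.card ι * L + 2 * C * R + 1) * 2 / (l * R ^ 2)) (heL : ∀ i, ‖e i‖ ^ 2 ≤ L)
    (hel : ∀ w, l * ‖w‖ ^ 2 ≤ ∑ i, inner ℝ w (e i) ^ 2) (hs1 : R / 2 ≤ ‖x - y‖)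
    (hs2 : ‖x - y‖ ≤ 3 * R / 2) :
    C * ‖fderiv ℝ (hopfBarrier α y) x‖ <
      ∑ i, fderiv ℝ (fderiv ℝ (hopfBarrier α y)) x (e i) (e i) := by
  have hα0 : 0 < α := by rw [hα]; positivity
  have hg : 0 < hopfBarrier α y x := Real.exp_pos _
  have h1 : ∑ i, ‖e i‖ ^ 2 ≤ Fintype.card ι * L := by
    simpa using Finset.sum_le_sum fun i (_ : i ∈ Finset.univ) => heL i
  have h2 := hel (x - y)
  have h3 := norm_fderiv_hopfBarrier_le hα0.le y x
  simp only [fderiv_fderiv_hopfBarrier]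
  rw [← Finset.mul_sum, Finset.sum_sub_distrib, ← Finset.mul_sum, ← Finset.mul_sum]
  generalize ∑ i, inner ℝ (x - y) (e i) ^ 2 = Q at *
  generalize ∑ i, ‖e i‖ ^ 2 = N at *
  generalize hopfBarrier α y x = g at *
  generalize ‖x - y‖ = s at *
  -- The choice of `α` makes `2 * α * l * (R / 2) ^ 2` equal to `card ι * L + 2 * C * R + 1`, which
  -- exceeds `N + C * s` whenever `s ≤ 3 * R / 2`.
  have h4 : α * (l * R ^ 2) = (Fintype.card ι * L + 2 * C * R + 1) * 2 := by
    rw [hα]; field_simp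
  have h5 : α * l * (R / 2) ^ 2 ≤ α * l * s ^ 2 := by gcongr
  have h6 : C * s ≤ C * (3 * R / 2) := by gcongr
  have h7 : 0 ≤ C * R := by positivity
  have h8 : N + C * s < 2 * α * Q := by
    have : α * (l * s ^ 2) ≤ α * Q := by gcongr
    linarith
  calc C * _ ≤ C * (2 * α * g * s) := by gcongr
    _ = 2 * α * g * (C * s) := by ring
    _ < 2 * α * g * (2 * α * Q - N) := by
      have : C * s < 2 * α * Q - N := by linarith
      gcongr
    _ = _ := by ring

/-- E. Hopf's strong maximum principle. The elliptic operator is given at every point by a frame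
`e`, as `f ↦ ∑ i, D²f (e i) (e i)`. -/
theorem IsLocalMax.eventually_eq_of_elliptic [FiniteDimensional ℝ E] {ι : Type*} [Fintype ι]
    {f : E → ℝ} {p : E} (hmax : IsLocalMax f p) (hf : ContDiffAt ℝ 2 f p) {l L C : ℝ} (hl : 0 < l)
    (hL : 0 ≤ L) (hC : 0 ≤ C)
    (hell : ∀ᶠ x in 𝓝 p, ∃ e : ι → E, (∀ i, ‖e i‖ ^ 2 ≤ L) ∧
      (∀ w, l * ‖w‖ ^ 2 ≤ ∑ i, inner ℝ w (e i) ^ 2) ∧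
      -(C * ‖fderiv ℝ f x‖) ≤ ∑ i, fderiv ℝ (fderiv ℝ f) x (e i) (e i)) :
    ∀ᶠ x in 𝓝 p, f x = f p := by
  obtain ⟨ε, hε, hball⟩ := Metric.eventually_nhds_iff.1
    ((hf.eventually (by simp)).and (hmax.and hell))
  set r := ε / 4 with hr
  have hr0 : 0 < r := by positivity
  refine Metric.eventually_nhds_iff.2 ⟨r, hr0, fun {y} hy => ?_⟩
  by_contra hne
  have hcont : ∀ x, dist x p < ε → ContinuousAt f x := fun x hx => (hball hx).1.continuousAt
  have hle : ∀ x, dist x p < ε → f x ≤ f p := fun x hx => (hball hx).2.1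
  -- a contact point `z` closest to `y`
  have hZ : IsCompact (closedBall p (2 * r) ∩ f ⁻¹' {f p}) := by
    have hc : ContinuousOn f (closedBall p (2 * r)) := fun x hx =>
      (hcont x (by rw [mem_closedBall] at hx; linarith)).continuousWithinAt
    exact (isCompact_closedBall p (2 * r)).of_isClosed_subset
      (hc.preimage_isClosed_of_isClosed isClosed_closedBall isClosed_singleton)
      Set.inter_subset_left
  have hpZ : p ∈ closedBall p (2 * r) ∩ f ⁻¹' {f p} := ⟨by simp [hr0.le], rfl⟩
  obtain ⟨z, ⟨-, hzf⟩, hzd⟩ := hZ.exists_infDist_eq_dist ⟨p, hpZ⟩ y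
  have hzf : f z = f p := hzf
  have hdr : dist y z < r := by
    rw [← hzd]; exact (infDist_le_dist_of_mem hpZ).trans_lt hy
  have hin : ∀ x, dist x y < dist y z → f x < f p := by
    intro x hx
    have hxp : dist x p < 2 * r := by linarith [dist_triangle x y p]
    refine lt_of_le_of_ne (hle x (by linarith)) fun h => ?_
    have := infDist_le_dist_of_mem (x := y)
      (show x ∈ closedBall p (2 * r) ∩ f ⁻¹' {f p} from ⟨hxp.le, h⟩)
    rw [hzd, dist_comm y x] at this
    linarith
  have hyz : y ≠ z := fun h => hne (h ▸ hzf)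
  -- The ball about the midpoint `c` with radius `R` is internally tangent at `z` to the ball about
  -- `y` through `z`, in which `f < f p`. So its closure meets the contact set only at `z`.
  set R := dist y z / 2 with hR
  have hR0 : 0 < R := by have := dist_pos.2 hyz; positivity
  set c := midpoint ℝ y z with hc
  have hczR : dist c z = R := by
    rw [hc, dist_midpoint_right]; simp [hR]; ring
  have htouch : ∀ x, dist x c ≤ R → x ≠ z → f x < f p := by
    intro x hx hxz
    refine hin x ?_
    have hpar : dist x y ^ 2 + dist x z ^ 2 = 2 * dist x c ^ 2 + 2 * R ^ 2 := by
      have h1 := parallelogram_law_with_norm ℝ (x - c) (c - z)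
      have e1 : x - c + (c - z) = x - z := by abel
      have e2 : x - c - (c - z) = x - y := by
        have : c + c = y + z := by rw [hc]; exact midpoint_add_self ℝ y z
        rw [show x - c - (c - z) = x - (c + c) + z by abel, this]; abel
      rw [e1, e2, ← dist_eq_norm, ← dist_eq_norm, ← dist_eq_norm, ← dist_eq_norm, hczR] at h1
      nlinarith
    have hpos : 0 < dist x z := dist_pos.2 hxz
    have h2 : dist x c ^ 2 ≤ R ^ 2 := by gcongr
    have h3 : dist y z = 2 * R := by rw [hR]; ring
    rw [h3]
    refine lt_of_pow_lt_pow_left₀ 2 (by positivity) ?_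
    nlinarith [pow_pos hpos 2]
  have hnear : ∀ x, dist x z ≤ R / 2 → dist x p < ε := by
    intro x hx
    have h1 := dist_triangle x z p
    have h2 := dist_triangle z y p
    rw [dist_comm z y] at h2
    linarith
  -- the barrier
  set α : ℝ := (Fintype.card ι * L + 2 * C * R + 1) * 2 / (l * R ^ 2) with hα
  have hα0 : 0 < α := by positivity
  set g := hopfBarrier α c with hg
  have hgpos : ∀ x, 0 < g x := fun x => Real.exp_pos _
  have hgle : ∀ x, g x ≤ 1 := hopfBarrier_le_one hα0.le c
  have hgout : ∀ x, R < dist x c → g x < g z := fun x hx =>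
    hopfBarrier_lt hα0 (by rwa [dist_comm z c, hczR])
  obtain ⟨δ, hδ, hδS⟩ : ∃ δ > 0, ∀ x ∈ sphere z (R / 2) ∩ closedBall c R, f x ≤ f p - δ := by
    have hS : IsCompact (sphere z (R / 2) ∩ closedBall c R) :=
      (isCompact_sphere z (R / 2)).inter_right isClosed_closedBall
    rcases Set.eq_empty_or_nonempty (sphere z (R / 2) ∩ closedBall c R) with h | h
    · exact ⟨1, one_pos, by simp [h]⟩
    · obtain ⟨s, hs, hsmax⟩ := hS.exists_isMaxOn h (f := f) fun x hx =>
        (hcont x (hnear x (mem_sphere.1 hx.1).le)).continuousWithinAt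
      have hsz : s ≠ z := by
        rintro rfl
        have := mem_sphere.1 hs.1
        rw [dist_self] at this
        linarith
      refine ⟨f p - f s, sub_pos.2 (htouch s hs.2 hsz), fun x hx => ?_⟩
      have : f x ≤ f s := hsmax hx
      linarith
  set w : E → ℝ := fun x => f x + δ * g x with hw
  have hgsm : ContDiff ℝ 2 g := contDiff_hopfBarrier α c
  have hwsm : ∀ x, dist x p < ε → ContDiffAt ℝ 2 w x := fun x hx =>
    (hball hx).1.add (contDiffAt_const.mul hgsm.contDiffAt)
  obtain ⟨x, hx, hxmax⟩ := (isCompact_closedBall z (R / 2)).exists_isMaxOn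
    ⟨z, mem_closedBall_self (by positivity)⟩ (f := w) fun x hx =>
      (hwsm x (hnear x hx)).continuousAt.continuousWithinAt
  have hxp : dist x p < ε := hnear x hx
  -- On the boundary sphere `w < w z`: within `closedBall c R` the drop `δ` of `f` outweighs `δ * g
  -- x ≤ δ`, and outside it `g x < g z`.
  have hxint : dist x z < R / 2 := by
    refine lt_of_le_of_ne hx fun hxs => ?_
    have h1 : w z ≤ w x := hxmax (mem_closedBall_self (by positivity))
    simp only [hw, hzf] at h1
    rcases le_or_gt (dist x c) R with h | h
    · have := hδS x ⟨hxs, h⟩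
      nlinarith [hgle x, hgpos z]
    · have := hle x hxp
      nlinarith [hgout x h]
  have hxloc : IsLocalMax w x := by
    filter_upwards [isOpen_ball.mem_nhds (mem_ball.2 hxint)] with x' hx'
    exact hxmax (ball_subset_closedBall hx')
  obtain ⟨hfx, -, e, heL, hel, hef⟩ := hball hxp
  have hfd : ∀ᶠ x' in 𝓝 x, fderiv ℝ w x' = fderiv ℝ f x' + δ • fderiv ℝ g x' := by
    filter_upwards [hfx.eventually (by simp)] with x' hx'
    have hg' : DifferentiableAt ℝ g x' := hgsm.contDiffAt.differentiableAt (by simp)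
    exact ((hx'.differentiableAt (by simp)).hasFDerivAt.add
      (hg'.hasFDerivAt.const_mul δ)).fderiv
  have hfdd : fderiv ℝ (fderiv ℝ w) x =
      fderiv ℝ (fderiv ℝ f) x + δ • fderiv ℝ (fderiv ℝ g) x := by
    rw [EventuallyEq.fderiv_eq hfd]
    have h1 : DifferentiableAt ℝ (fderiv ℝ f) x :=
      (hfx.fderiv_right (m := 1) (by norm_num)).differentiableAt (by simp)
    have h2 : DifferentiableAt ℝ (fderiv ℝ g) x :=
      (hgsm.contDiffAt.fderiv_right (m := 1) (by norm_num)).differentiableAt (by simp)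
    exact (h1.hasFDerivAt.add (h2.hasFDerivAt.const_smul δ)).fderiv
  -- At the interior maximum of `w` the gradients of `f` and `δ * g` cancel and the trace of the
  -- Hessian is nonpositive, against the strict subsolution property of `g`.
  have hgrad : fderiv ℝ f x = -(δ • fderiv ℝ g x) := by
    have := hxloc.fderiv_eq_zero
    rw [hfd.self_of_nhds] at this
    exact eq_neg_of_add_eq_zero_left this
  have hnorm : ‖fderiv ℝ f x‖ = δ * ‖fderiv ℝ g x‖ := by
    rw [hgrad, norm_neg, norm_smul, Real.norm_eq_abs, abs_of_pos hδ]
  have hsum : ∑ i, fderiv ℝ (fderiv ℝ f) x (e i) (e i) +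
      δ * ∑ i, fderiv ℝ (fderiv ℝ g) x (e i) (e i) ≤ 0 := by
    rw [Finset.mul_sum, ← Finset.sum_add_distrib]
    refine Finset.sum_nonpos fun i _ => ?_
    have := hxloc.fderiv_fderiv_apply_self_nonpos (hwsm x hxp) (e i)
    rw [hfdd] at this
    simpa using this
  have hs1 : R / 2 ≤ ‖x - c‖ := by
    rw [← dist_eq_norm]
    have := dist_triangle c x z
    rw [hczR, dist_comm c x] at this
    linarith
  have hs2 : ‖x - c‖ ≤ 3 * R / 2 := by
    rw [← dist_eq_norm]
    have := dist_triangle x z c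
    rw [dist_comm z c, hczR] at this
    linarith
  have hgsum : C * ‖fderiv ℝ g x‖ < ∑ i, fderiv ℝ (fderiv ℝ g) x (e i) (e i) :=
    lt_sum_fderiv_fderiv_hopfBarrier hl hL hC hR0 hα heL hel hs1 hs2
  rw [hnorm] at hef
  have := mul_lt_mul_of_pos_left hgsum hδ
  linarith

end MaximumPrinciple

theorem IsLocalExtr.eventually_eq_of_elliptic {E : Type*} [NormedAddCommGroup E]
    [InnerProductSpace ℝ E] [FiniteDimensional ℝ E] {ι : Type*} [Fintype ι]
    {f : E → ℝ} {p : E} (hext : IsLocalExtr f p) (hf : ContDiffAt ℝ 2 f p) {l L C : ℝ} (hl : 0 < l)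
    (hL : 0 ≤ L) (hC : 0 ≤ C)
    (hell : ∀ᶠ x in 𝓝 p, ∃ e : ι → E, (∀ i, ‖e i‖ ^ 2 ≤ L) ∧
      (∀ w, l * ‖w‖ ^ 2 ≤ ∑ i, inner ℝ w (e i) ^ 2) ∧
      |∑ i, fderiv ℝ (fderiv ℝ f) x (e i) (e i)| ≤ C * ‖fderiv ℝ f x‖) :
    ∀ᶠ x in 𝓝 p, f x = f p := by
  rcases hext with h | h
  · have := IsLocalMax.eventually_eq_of_elliptic (f := fun x => -f x)
      (IsLocalMin.neg h) hf.neg hl hL hC (ι := ι)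
      (by
        filter_upwards [hell] with x ⟨e, h1, h2, h3⟩
        refine ⟨e, h1, h2, ?_⟩
        have e1 : fderiv ℝ (fun x => -f x) = fun x => -fderiv ℝ f x := by
          ext1 y; exact fderiv_fun_neg
        rw [e1, fderiv_fun_neg, norm_neg]
        simp only [neg_apply, Finset.sum_neg_distrib]
        exact neg_le_neg ((le_abs_self _).trans h3))
    simpa using this
  · refine IsLocalMax.eventually_eq_of_elliptic h hf hl hL hC ?_ (ι := ι)
    filter_upwards [hell] with x ⟨e, h1, h2, h3⟩
    exact ⟨e, h1, h2, (abs_le.1 h3).1⟩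

theorem IsLocalMin.fderiv_fderiv_apply_self_nonneg {E : Type*} [NormedAddCommGroup E]
    [InnerProductSpace ℝ E] {f : E → ℝ} {x : E} (hmin : IsLocalMin f x) (hf : ContDiffAt ℝ 2 f x)
    (v : E) : 0 ≤ fderiv ℝ (fderiv ℝ f) x v v := by
  have h1 := IsLocalMax.fderiv_fderiv_apply_self_nonpos (f := fun x => -f x)
    (IsLocalMin.neg hmin) hf.neg v
  have h2 : fderiv ℝ (fun x => -f x) = fun x => -fderiv ℝ f x := by
    ext1 y; exact fderiv_fun_neg
  rw [h2, fderiv_fun_neg, neg_apply, neg_apply] at h1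
  linarith

/-! ### Frames orthonormal for the induced metric -/

section Frame

variable {E F : Type*} [NormedAddCommGroup E] [InnerProductSpace ℝ E]
  [NormedAddCommGroup F] [InnerProductSpace ℝ F] {ι : Type*} [Fintype ι]

/-- An injective linear map to an inner product space admits a basis orthonormal for the induced
inner product. -/
theorem exists_basis_orthonormal_comp [FiniteDimensional ℝ E] (A : E →L[ℝ] F) (hA : Function.Injective A) :
    ∃ b : Basis (Fin (finrank ℝ E)) ℝ E, Orthonormal ℝ fun i => A (b i) := by
  let T : E ≃ₗ[ℝ] A.toLinearMap.range := LinearEquiv.ofInjective A.toLinearMap hA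
  let o := (stdOrthonormalBasis ℝ A.toLinearMap.range).reindex (finCongr T.finrank_eq.symm)
  refine ⟨o.toBasis.map T.symm, ?_⟩
  have h : ∀ i, A ((o.toBasis.map T.symm) i) = (o i : F) := fun i => by
    have := congrArg Subtype.val (T.apply_symm_apply (o i))
    exact this
  simp only [h]
  exact o.orthonormal.comp_linearIsometry A.toLinearMap.range.subtypeₗᵢ

theorem Module.Basis.repr_eq_inner_of_orthonormal {b : Basis ι ℝ E} {A : E →L[ℝ] F}
    (hb : Orthonormal ℝ fun i => A (b i)) (v : E) (i : ι) :
    b.repr v i = inner ℝ (A (b i)) (A v) := by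
  conv_rhs => rw [← b.sum_repr v, map_sum]
  simp only [map_smul]
  exact (hb.inner_right_fintype _ i).symm

theorem trace_eq_sum_inner_of_orthonormal {b : Basis ι ℝ E} {A : E →L[ℝ] F}
    (hb : Orthonormal ℝ fun i => A (b i)) (S : E →ₗ[ℝ] E) :
    LinearMap.trace ℝ E S = ∑ i, inner ℝ (A (b i)) (A (S (b i))) := by
  classical
  rw [LinearMap.trace_eq_matrix_trace ℝ b, Matrix.trace]
  refine Finset.sum_congr rfl fun i _ => ?_
  rw [Matrix.diag_apply, LinearMap.toMatrix_apply, Basis.repr_eq_inner_of_orthonormal hb]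

/-- Lower ellipticity bound. Cauchy–Schwarz is applied to `‖w‖ ^ 2 = ∑ (b.repr w i) * ⟨w, b i⟩`,
where the squared coordinates sum to `‖A w‖ ^ 2`. -/
theorem norm_sq_le_sum_inner_sq_of_orthonormal {b : Basis ι ℝ E} {A : E →L[ℝ] F}
    (hb : Orthonormal ℝ fun i => A (b i)) (w : E) :
    ‖w‖ ^ 2 ≤ ‖A‖ ^ 2 * ∑ i, inner ℝ w (b i) ^ 2 := by
  have h1 : ‖A w‖ ^ 2 = ∑ i, b.repr w i ^ 2 := by
    have : A w = ∑ i, b.repr w i • A (b i) := by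
      conv_lhs => rw [← b.sum_repr w, map_sum]
      simp only [map_smul]
    rw [this, ← real_inner_self_eq_norm_sq, hb.inner_sum]
    simp [sq]
  have h2 : ‖w‖ ^ 2 = ∑ i, b.repr w i * inner ℝ w (b i) := by
    rw [← real_inner_self_eq_norm_sq]
    conv_lhs => rw [← b.sum_repr w, inner_sum, b.sum_repr w]
    simp [inner_smul_right]
  have h3 := Finset.sum_mul_sq_le_sq_mul_sq Finset.univ (fun i => b.repr w i)
    fun i => inner ℝ w (b i)
  rw [← h2, ← h1] at h3
  have h4 : ‖A w‖ ^ 2 ≤ ‖A‖ ^ 2 * ‖w‖ ^ 2 := by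
    rw [← mul_pow]; gcongr; exact A.le_opNorm w
  have hQ : 0 ≤ ∑ i, inner ℝ w (b i) ^ 2 := Finset.sum_nonneg fun i _ => sq_nonneg _
  rcases eq_or_ne w 0 with rfl | hw
  · simp
  · have : 0 < ‖w‖ ^ 2 := by positivity
    refine le_of_mul_le_mul_left ?_ this
    nlinarith [mul_le_mul_of_nonneg_right h4 hQ]

/-- The range of `A` lies in the hyperplane orthogonal to `ν` and has the same dimension, so the two
coincide. -/
theorem exists_apply_eq_of_inner_eq_zero [FiniteDimensional ℝ F]
    (hdim : finrank ℝ F = finrank ℝ E + 1) {A : E →L[ℝ] F} (hA : Function.Injective A) {ν : F}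
    (hν : ‖ν‖ = 1) (hAν : ∀ v, inner ℝ (A v) ν = 0) {u : F} (hu : inner ℝ u ν = 0) :
    ∃ v, A v = u := by
  have hν0 : ν ≠ 0 := by rintro rfl; simp at hν
  have hle : A.toLinearMap.range ≤ (Submodule.span ℝ {ν})ᗮ := by
    rintro _ ⟨v, rfl⟩
    exact Submodule.mem_orthogonal_singleton_iff_inner_left.2 (hAν v)
  have hr : finrank ℝ A.toLinearMap.range = finrank ℝ E := LinearMap.finrank_range_of_inj hA
  have hs : finrank ℝ (Submodule.span ℝ {ν})ᗮ = finrank ℝ E := by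
    have := (Submodule.span ℝ {ν}).finrank_add_finrank_orthogonal
    rw [finrank_span_singleton hν0] at this
    omega
  have heq := Submodule.eq_of_le_of_finrank_eq hle (hr.trans hs.symm)
  have : u ∈ A.toLinearMap.range := by
    rw [heq]; exact Submodule.mem_orthogonal_singleton_iff_inner_left.2 hu
  exact this

/-- If the trace of the second fundamental form `B` in the normal direction `ν` is controlled by
`‖ν - a‖`, then its trace in the direction `a` is controlled by the part of `a` tangent to the range
of `A`. -/
theorem abs_sum_inner_le_of_abs_sum_inner_normal_le [FiniteDimensional ℝ F]
    (hdim : finrank ℝ F = finrank ℝ E + 1) {A : E →L[ℝ] F} {B : E →L[ℝ] E →L[ℝ] F} {ν a : F}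
    {c D K : ℝ} (hc : 0 < c) (hK : 0 ≤ K) (hA : ∀ v, c * ‖v‖ ≤ ‖A v‖) (hB : ‖B‖ ≤ D)
    (hν : ‖ν‖ = 1) (ha : ‖a‖ = 1) (hAν : ∀ v, inner ℝ (A v) ν = 0) (hνa : 0 ≤ inner ℝ a ν)
    {b : Basis ι ℝ E} (hb : Orthonormal ℝ fun i => A (b i))
    (hsum : |∑ i, inner ℝ ν (B (b i) (b i))| ≤ K * ‖ν - a‖) :
    |∑ i, inner ℝ a (B (b i) (b i))| ≤
      (2 * K + Fintype.card ι * (D * (1 / c) ^ 2)) / c * ‖(innerSL ℝ a).comp A‖ := by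
  set s : ℝ := inner ℝ a ν with hs
  have hinj : Function.Injective A := by
    refine (injective_iff_map_eq_zero A).2 fun v hv => ?_
    have := hA v
    rw [hv, norm_zero] at this
    have h0 : ‖v‖ ≤ 0 := by
      by_contra! h
      nlinarith [mul_pos hc h]
    exact norm_le_zero_iff.1 h0
  have hνν : inner ℝ ν ν = (1 : ℝ) := by rw [real_inner_self_eq_norm_sq, hν]; norm_num
  have haa : inner ℝ a a = (1 : ℝ) := by rw [real_inner_self_eq_norm_sq, ha]; norm_num
  have hνa' : inner ℝ ν a = s := real_inner_comm _ _
  have htan : inner ℝ (a - s • ν) ν = (0 : ℝ) := by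
    rw [inner_sub_left, real_inner_smul_left, hνν, ← hs]; ring
  obtain ⟨v, hv⟩ := exists_apply_eq_of_inner_eq_zero hdim hinj hν hAν htan
  set t := ‖a - s • ν‖ with ht
  have ht0 : 0 ≤ t := norm_nonneg _
  have hts : t ^ 2 = 1 - s ^ 2 := by
    rw [ht, ← real_inner_self_eq_norm_sq, inner_sub_right, real_inner_smul_right, htan,
      inner_sub_left, real_inner_smul_left, haa, hνa']
    ring
  have hs1 : s ≤ 1 := by nlinarith
  -- Here `‖ν - a‖ ^ 2 = 2 - 2 * s` and `t ^ 2 = 1 - s ^ 2`; the sign `0 ≤ s` keeps `ν` away from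
  -- `-a`, where the bound fails.
  have hdiff : ‖ν - a‖ ≤ 2 * t := by
    refine le_of_sq_le_sq ?_ (by positivity)
    rw [← real_inner_self_eq_norm_sq, inner_sub_right, inner_sub_left, inner_sub_left, hνν, haa,
      hνa', ← hs, mul_pow, hts]
    nlinarith
  -- The differential `⟨a, A ·⟩` takes the value `t ^ 2` at `v`, while `‖v‖ ≤ t / c`.
  have htg : t ≤ ‖(innerSL ℝ a).comp A‖ / c := by
    have h1 : t ^ 2 ≤ ‖(innerSL ℝ a).comp A‖ * ‖v‖ := by
      have h2 : ((innerSL ℝ a).comp A) v = t ^ 2 := by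
        simp only [ContinuousLinearMap.comp_apply, innerSL_apply_apply, hv]
        rw [inner_sub_right, real_inner_smul_right, haa, ← hs, hts]; ring
      rw [← h2]
      exact (le_abs_self _).trans (((innerSL ℝ a).comp A).le_opNorm v)
    have h3 : c * ‖v‖ ≤ t := by rw [ht, ← hv]; exact hA v
    rw [le_div_iff₀ hc]
    rcases ht0.eq_or_lt with h | h
    · rw [← h, zero_mul]; positivity
    · refine le_of_mul_le_mul_right ?_ h
      have := mul_le_mul_of_nonneg_left h3 (norm_nonneg ((innerSL ℝ a).comp A))
      nlinarith
  have hbn : ∀ i, ‖b i‖ ≤ 1 / c := fun i => by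
    rw [le_div_iff₀ hc, mul_comm, ← hb.1 i]; exact hA _
  have htansum : |∑ i, inner ℝ (a - s • ν) (B (b i) (b i))| ≤
      Fintype.card ι * (D * (1 / c) ^ 2) * t := by
    calc |∑ i, inner ℝ (a - s • ν) (B (b i) (b i))|
        ≤ ∑ i, |inner ℝ (a - s • ν) (B (b i) (b i))| := Finset.abs_sum_le_sum_abs _ _
      _ ≤ ∑ _i : ι, t * (D * (1 / c) ^ 2) := by
          refine Finset.sum_le_sum fun i _ => (abs_real_inner_le_norm _ _).trans ?_
          refine mul_le_mul_of_nonneg_left ?_ ht0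
          refine (B.le_opNorm₂ _ _).trans ?_
          rw [mul_assoc, ← sq]
          have := hbn i
          gcongr
          exact (norm_nonneg B).trans hB
      _ = _ := by simp; ring
  have hsplit : ∑ i, inner ℝ a (B (b i) (b i)) =
      s * ∑ i, inner ℝ ν (B (b i) (b i)) + ∑ i, inner ℝ (a - s • ν) (B (b i) (b i)) := by
    rw [Finset.mul_sum, ← Finset.sum_add_distrib]
    refine Finset.sum_congr rfl fun i _ => ?_
    rw [inner_sub_left, real_inner_smul_left]; ring
  have hD : 0 ≤ D := (norm_nonneg B).trans hB
  calc |∑ i, inner ℝ a (B (b i) (b i))|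
      ≤ |s * ∑ i, inner ℝ ν (B (b i) (b i))| + |∑ i, inner ℝ (a - s • ν) (B (b i) (b i))| := by
        rw [hsplit]; exact abs_add_le _ _
    _ ≤ 1 * (K * (2 * t)) + Fintype.card ι * (D * (1 / c) ^ 2) * t := by
        rw [abs_mul, abs_of_nonneg hνa]
        gcongr
        exact hsum.trans (by gcongr)
    _ = (2 * K + Fintype.card ι * (D * (1 / c) ^ 2)) * t := by ring
    _ ≤ (2 * K + Fintype.card ι * (D * (1 / c) ^ 2)) * (‖(innerSL ℝ a).comp A‖ / c) := by
        gcongr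
    _ = _ := by ring

end Frame

/-! ### Second fundamental form and height of a parametrized hypersurface -/

section LocalHypersurface

variable {E F : Type*} [NormedAddCommGroup E] [InnerProductSpace ℝ E]
  [NormedAddCommGroup F] [InnerProductSpace ℝ F]

theorem fderiv_inner_const_left {ψ : E → F} {x : E} (hψ : DifferentiableAt ℝ ψ x) (a : F) :
    fderiv ℝ (fun x => inner ℝ a (ψ x)) x = (innerSL ℝ a).comp (fderiv ℝ ψ x) :=
  ((innerSL ℝ a).hasFDerivAt.comp x hψ.hasFDerivAt).fderiv

theorem fderiv_fderiv_inner_const_left {ψ : E → F} {x : E} (hψ : ContDiffAt ℝ 2 ψ x) (a : F)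
    (v w : E) :
    fderiv ℝ (fderiv ℝ fun x => inner ℝ a (ψ x)) x v w =
      inner ℝ a (fderiv ℝ (fderiv ℝ ψ) x v w) := by
  have h1 : fderiv ℝ (fun x => inner ℝ a (ψ x)) =ᶠ[𝓝 x]
      fun y => ContinuousLinearMap.compL ℝ E F ℝ (innerSL ℝ a) (fderiv ℝ ψ y) := by
    filter_upwards [hψ.eventually (by simp)] with y hy
    exact fderiv_inner_const_left (hy.differentiableAt (by simp)) a
  have h2 : DifferentiableAt ℝ (fderiv ℝ ψ) x :=
    (hψ.fderiv_right (m := 1) (by norm_num)).differentiableAt (by simp)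
  have h3 := (ContinuousLinearMap.compL ℝ E F ℝ (innerSL ℝ a)).hasFDerivAt.comp x h2.hasFDerivAt
  have h4 : fderiv ℝ (fun y => ContinuousLinearMap.compL ℝ E F ℝ (innerSL ℝ a) (fderiv ℝ ψ y)) x =
    _ := h3.fderiv
  rw [h1.fderiv_eq, h4]
  simp

/-- Weingarten's equation. -/
theorem inner_fderiv_fderiv_eq_neg_inner_fderiv {ψ η : E → F} {x : E} (hψ : ContDiffAt ℝ 2 ψ x)
    (hη : DifferentiableAt ℝ η x) (horth : ∀ᶠ y in 𝓝 x, ∀ v, inner ℝ (fderiv ℝ ψ y v) (η y) = 0)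
    (v w : E) :
    inner ℝ (η x) (fderiv ℝ (fderiv ℝ ψ) x v w) = -inner ℝ (fderiv ℝ ψ x w) (fderiv ℝ η x v) := by
  have h2 : DifferentiableAt ℝ (fderiv ℝ ψ) x :=
    (hψ.fderiv_right (m := 1) (by norm_num)).differentiableAt (by simp)
  have h3 : HasFDerivAt (fun y => fderiv ℝ ψ y w)
      ((ContinuousLinearMap.apply ℝ F w).comp (fderiv ℝ (fderiv ℝ ψ) x)) x :=
    (ContinuousLinearMap.apply ℝ F w).hasFDerivAt.comp x h2.hasFDerivAt
  have h4 := h3.inner ℝ hη.hasFDerivAt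
  have h5 : (fun y => inner ℝ (fderiv ℝ ψ y w) (η y)) =ᶠ[𝓝 x] fun _ => (0 : ℝ) := by
    filter_upwards [horth] with y hy using hy w
  have h6 := DFunLike.congr_fun (h4.fderiv.symm.trans h5.fderiv_eq) v
  simp at h6
  rw [real_inner_comm]
  linarith

theorem trace_eq_sum_inner_fderiv_fderiv [FiniteDimensional ℝ E] {ι : Type*} [Fintype ι]
    {ψ η : E → F} {x : E}
    (hψ : ContDiffAt ℝ 2 ψ x) (hη : DifferentiableAt ℝ η x)
    (horth : ∀ᶠ y in 𝓝 x, ∀ v, inner ℝ (fderiv ℝ ψ y v) (η y) = 0) {S : E →ₗ[ℝ] E}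
    (hS : ∀ v, fderiv ℝ ψ x (S v) = -fderiv ℝ η x v) {b : Basis ι ℝ E}
    (hb : Orthonormal ℝ fun i => fderiv ℝ ψ x (b i)) :
    LinearMap.trace ℝ E S = ∑ i, inner ℝ (η x) (fderiv ℝ (fderiv ℝ ψ) x (b i) (b i)) := by
  rw [trace_eq_sum_inner_of_orthonormal hb]
  refine Finset.sum_congr rfl fun i _ => ?_
  rw [inner_fderiv_fderiv_eq_neg_inner_fderiv hψ hη horth, hS, inner_neg_right]

theorem fderiv_inner_self_eq_zero {η : E → F} {x : E} (hη : DifferentiableAt ℝ η x)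
    (hunit : ∀ᶠ y in 𝓝 x, ‖η y‖ = 1) (v : E) : inner ℝ (fderiv ℝ η x v) (η x) = 0 := by
  have h4 := hη.hasFDerivAt.inner ℝ hη.hasFDerivAt
  have h5 : (fun y => inner ℝ (η y) (η y)) =ᶠ[𝓝 x] fun _ => (1 : ℝ) := by
    filter_upwards [hunit] with y hy
    rw [real_inner_self_eq_norm_sq, hy]; norm_num
  have h6 := DFunLike.congr_fun (h4.fderiv.symm.trans h5.fderiv_eq) v
  simp [real_inner_comm] at h6
  rw [real_inner_comm]
  linarith

/-- A hypersurface whose mean curvature is bounded by the distance of its normal to `a`, and whose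
height in the direction `a` has a local extremum at a point with normal `a`, is locally a
hyperplane. -/
theorem IsLocalExtr.eventually_inner_eq_of_sum_inner_fderiv_le [FiniteDimensional ℝ E]
    [FiniteDimensional ℝ F] (hdim : finrank ℝ F = finrank ℝ E + 1) {ψ η : E → F} {p : E} {a : F}
    {K : ℝ} (hK : 0 ≤ K) (hψ : ContDiffAt ℝ 2 ψ p) (hη : ContinuousAt η p)
    (hinj : Function.Injective (fderiv ℝ ψ p)) (hunit : ∀ᶠ y in 𝓝 p, ‖η y‖ = 1) (hηp : η p = a)
    (horth : ∀ᶠ y in 𝓝 p, ∀ v, inner ℝ (fderiv ℝ ψ y v) (η y) = 0)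
    (hmean : ∀ᶠ y in 𝓝 p, ∀ b : Basis (Fin (finrank ℝ E)) ℝ E,
      (Orthonormal ℝ fun i => fderiv ℝ ψ y (b i)) →
        |∑ i, inner ℝ (η y) (fderiv ℝ (fderiv ℝ ψ) y (b i) (b i))| ≤ K * ‖η y - a‖)
    (hext : IsLocalExtr (fun y => inner ℝ a (ψ y)) p) :
    ∀ᶠ y in 𝓝 p, inner ℝ a (ψ y) = (inner ℝ a (ψ p) : ℝ) := by
  have ha : ‖a‖ = 1 := hηp ▸ hunit.self_of_nhds
  obtain ⟨k, hk, hanti⟩ := (fderiv ℝ ψ p).exists_antilipschitzWith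
    (LinearMap.ker_eq_bot.2 hinj)
  -- Half the lower bound of the differential at `p`, so that it persists nearby; the `+ 1` in `D`
  -- and `N` serves the same purpose for the upper bounds.
  set c : ℝ := (k : ℝ)⁻¹ / 2 with hc
  have hk0 : (0 : ℝ) < k := by exact_mod_cast hk
  have hc0 : 0 < c := by positivity
  have hbound : ∀ v, 2 * c * ‖v‖ ≤ ‖fderiv ℝ ψ p v‖ := fun v => by
    have := hanti.le_mul_dist v 0
    rw [map_zero, dist_zero_right, dist_zero_right] at this
    rw [hc, mul_div_cancel₀ _ two_ne_zero, inv_mul_le_iff₀ hk0]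
    exact this
  have hd1 : ContinuousAt (fderiv ℝ ψ) p :=
    (hψ.fderiv_right (m := 1) (by norm_num)).continuousAt
  have hd2 : ContinuousAt (fderiv ℝ (fderiv ℝ ψ)) p :=
    ((hψ.fderiv_right (m := 1) (by norm_num)).fderiv_right (m := 0) (by norm_num)).continuousAt
  set D := ‖fderiv ℝ (fderiv ℝ ψ) p‖ + 1 with hD
  set N := ‖fderiv ℝ ψ p‖ + 1 with hN
  have hN0 : 0 < N := by positivity
  have e1 : ∀ᶠ y in 𝓝 p, ‖fderiv ℝ (fderiv ℝ ψ) y‖ < D :=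
    (ContinuousAt.norm (E := E →L[ℝ] E →L[ℝ] F) hd2).tendsto.eventually_lt_const
      (lt_add_one _)
  have e2 : ∀ᶠ y in 𝓝 p, ‖fderiv ℝ ψ y‖ < N :=
    hd1.norm.tendsto.eventually_lt_const (lt_add_one _)
  have e3 : ∀ᶠ y in 𝓝 p, ∀ v, c * ‖v‖ ≤ ‖fderiv ℝ ψ y v‖ := by
    filter_upwards [Metric.tendsto_nhds.1 hd1 c hc0] with y hy v
    rw [dist_eq_norm, norm_sub_rev] at hy
    have h1 := (fderiv ℝ ψ p - fderiv ℝ ψ y).le_of_opNorm_le hy.le v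
    have h2 := hbound v
    have h3 := norm_sub_norm_le (fderiv ℝ ψ p v) (fderiv ℝ ψ y v)
    rw [sub_apply] at h1
    linarith
  have e4 : ∀ᶠ y in 𝓝 p, (0 : ℝ) < inner ℝ a (η y) := by
    refine continuousAt_const.eventually_lt (continuousAt_const.inner hη) ?_
    rw [hηp, real_inner_self_eq_norm_sq, ha]; norm_num
  have hsm : ContDiffAt ℝ 2 (fun y => inner ℝ a (ψ y)) p := contDiffAt_const.inner ℝ hψ
  refine hext.eventually_eq_of_elliptic (ι := Fin (finrank ℝ E)) hsm (l := 1 / N ^ 2)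
    (L := (1 / c) ^ 2) (C := (2 * K + Fintype.card (Fin (finrank ℝ E)) * (D * (1 / c) ^ 2)) / c)
    (by positivity) (by positivity) (by positivity) ?_
  filter_upwards [e1, e2, e3, e4, hunit, horth, hmean, hψ.eventually (by simp)]
    with y h1 h2 h3 h4 h5 h6 h7 h8
  have hinj' : Function.Injective (fderiv ℝ ψ y) := by
    refine (injective_iff_map_eq_zero _).2 fun v hv => ?_
    have := h3 v
    rw [hv, norm_zero] at this
    exact norm_le_zero_iff.1 (nonpos_of_mul_nonpos_right this hc0)
  obtain ⟨b, hb⟩ := exists_basis_orthonormal_comp (fderiv ℝ ψ y) hinj'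
  refine ⟨b, fun i => ?_, fun w => ?_, ?_⟩
  · have : ‖b i‖ ≤ 1 / c := by
      rw [le_div_iff₀ hc0, mul_comm, ← hb.1 i]; exact h3 _
    gcongr
  · rw [one_div, inv_mul_le_iff₀ (by positivity)]
    refine (norm_sq_le_sum_inner_sq_of_orthonormal hb w).trans ?_
    have : 0 ≤ ∑ i, inner ℝ w (b i) ^ 2 := Finset.sum_nonneg fun i _ => sq_nonneg _
    gcongr
  · rw [fderiv_inner_const_left (h8.differentiableAt (by simp))]
    simp only [fderiv_fderiv_inner_const_left h8]
    exact abs_sum_inner_le_of_abs_sum_inner_normal_le hdim hc0 hK h3 h1.le h5 ha h6 h4.le hb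
      (h7 b hb)

end LocalHypersurface

/-- A `C¹` function on the sphere vanishing at `a` is `O(‖y - a‖)` near `a`. -/
theorem exists_eventually_abs_le_of_contMDiffAt_sphere {n : ℕ}
    {𝓗 : sphere (0 : EuclideanSpace ℝ (Fin (n + 1))) 1 → ℝ}
    {a : sphere (0 : EuclideanSpace ℝ (Fin (n + 1))) 1}
    (h𝓗 : ContMDiffAt (𝓡 n) 𝓘(ℝ, ℝ) 1 𝓗 a) (ha : 𝓗 a = 0) :
    ∃ K : ℝ, 0 ≤ K ∧ ∀ᶠ y in 𝓝 a, |𝓗 y| ≤ K * ‖(y : EuclideanSpace ℝ (Fin (n + 1))) - a‖ := by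
  have := Fact.mk (@finrank_euclideanSpace_fin ℝ _ (n + 1))
  have h1 := (contMDiffAt_iff.1 h𝓗).2
  simp only [extChartAt_self_eq, modelWithCornersSelf_coe, Set.range_id, contDiffWithinAt_univ,
    Function.comp_def, id] at h1
  obtain ⟨K₁, s, hs, hK₁⟩ := h1.exists_lipschitzOnWith
  have hv : ‖((-a : sphere (0 : EuclideanSpace ℝ (Fin (n + 1))) 1) :
      EuclideanSpace ℝ (Fin (n + 1)))‖ = 1 := norm_eq_of_mem_sphere _
  have h2 : ContDiffAt ℝ 1 (stereoToFun ((-a : sphere (0 : EuclideanSpace ℝ (Fin (n + 1))) 1) :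
      EuclideanSpace ℝ (Fin (n + 1)))) a := by
    refine contDiffOn_stereoToFun.contDiffAt (IsOpen.mem_nhds ?_ ?_)
    · exact isOpen_ne_fun (by fun_prop) (by fun_prop)
    · have : inner ℝ (a : EuclideanSpace ℝ (Fin (n + 1))) a = (1 : ℝ) := by
        rw [real_inner_self_eq_norm_sq, norm_eq_of_mem_sphere]; norm_num
      simp only [Set.mem_ofPred_eq, innerSL_apply_apply, coe_neg_sphere, inner_neg_left, this]
      norm_num
  obtain ⟨K₂, t, ht, hK₂⟩ := h2.exists_lipschitzOnWith
  refine ⟨K₁ * K₂, by positivity, ?_⟩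
  have hcont : ContinuousAt (extChartAt (𝓡 n) a) a := continuousAt_extChartAt a
  filter_upwards [hcont.eventually hs, continuous_subtype_val.continuousAt.eventually ht,
    extChartAt_source_mem_nhds (I := 𝓡 n) a] with y hy1 hy2 hy3
  have h4 := hK₁.dist_le_mul _ hy1 _ (mem_of_mem_nhds hs)
  have h5 := hK₂.dist_le_mul _ hy2 _ (mem_of_mem_nhds ht)
  -- The chart at `a` is stereographic projection from `-a` followed by a linear isometry, so the
  -- ambient Lipschitz bound for `stereoToFun` passes to the chart.
  have h6 : dist (extChartAt (𝓡 n) a y) (extChartAt (𝓡 n) a a) =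
      dist (stereoToFun ((-a : sphere (0 : EuclideanSpace ℝ (Fin (n + 1))) 1) :
        EuclideanSpace ℝ (Fin (n + 1))) (y : EuclideanSpace ℝ (Fin (n + 1))))
        (stereoToFun ((-a : sphere (0 : EuclideanSpace ℝ (Fin (n + 1))) 1) :
        EuclideanSpace ℝ (Fin (n + 1))) a) :=
    (OrthonormalBasis.fromOrthogonalSpanSingleton n
      (ne_zero_of_mem_unit_sphere (-a))).repr.dist_map _ _
  rw [(extChartAt (𝓡 n) a).left_inv hy3, (extChartAt (𝓡 n) a).left_inv (mem_extChartAt_source a),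
    ha, h6, Real.dist_eq, sub_zero] at h4
  rw [← dist_eq_norm, mul_assoc]
  exact h4.trans (by gcongr)

/-! ### Transfer to charts of the manifold -/

section Charts

variable {n : ℕ} {M : Type*} [TopologicalSpace M] [ChartedSpace (EuclideanSpace ℝ (Fin n)) M]
section Extr

variable {F : Type*} {f : F → ℝ} {g : M → F} {p : M}

theorem tendsto_extChartAt_symm_nhds (p : M) :
    Tendsto (extChartAt (𝓡 n) p).symm (𝓝 (extChartAt (𝓡 n) p p)) (𝓝 p) := by
  simpa using (continuousAt_extChartAt_symm (I := 𝓡 n) p).tendsto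

theorem IsLocalMax.comp_extChartAt_symm (h : IsLocalMax (fun q => f (g q)) p) :
    IsLocalMax (fun y => f ((g ∘ (extChartAt (𝓡 n) p).symm) y)) (extChartAt (𝓡 n) p p) :=
  IsMaxFilter.comp_tendsto (f := fun q => f (g q)) (l := 𝓝 p) (by simpa using! h)
    (tendsto_extChartAt_symm_nhds p)

theorem IsLocalMin.comp_extChartAt_symm (h : IsLocalMin (fun q => f (g q)) p) :
    IsLocalMin (fun y => f ((g ∘ (extChartAt (𝓡 n) p).symm) y)) (extChartAt (𝓡 n) p p) :=
  IsMinFilter.comp_tendsto (f := fun q => f (g q)) (l := 𝓝 p) (by simpa using! h)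
    (tendsto_extChartAt_symm_nhds p)

theorem IsLocalExtr.comp_extChartAt_symm (h : IsLocalExtr (fun q => f (g q)) p) :
    IsLocalExtr (fun y => f ((g ∘ (extChartAt (𝓡 n) p).symm) y)) (extChartAt (𝓡 n) p p) :=
  h.elim (fun h => Or.inl (IsLocalMin.comp_extChartAt_symm h))
    fun h => Or.inr (IsLocalMax.comp_extChartAt_symm h)

end Extr

variable [IsManifold (𝓡 n) 2 M]

/-- `T` is the differential of the inverse chart. It is chosen before `g`, so that `ψ` and `η` are
read through the same isomorphism. -/
theorem exists_fderiv_comp_extChartAt_symm_eq (p : M) {x : EuclideanSpace ℝ (Fin n)}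
    (hx : x ∈ (extChartAt (𝓡 n) p).target) :
    ∃ T : EuclideanSpace ℝ (Fin n) ≃ₗ[ℝ] TangentSpace (𝓡 n) ((extChartAt (𝓡 n) p).symm x),
      ∀ {F : Type} [NormedAddCommGroup F] [NormedSpace ℝ F] (g : M → F),
        MDifferentiableAt (𝓡 n) 𝓘(ℝ, F) g ((extChartAt (𝓡 n) p).symm x) →
        ∀ v, fderiv ℝ (g ∘ (extChartAt (𝓡 n) p).symm) x v =
          mvfderiv (𝓡 n) g ((extChartAt (𝓡 n) p).symm x) (T v) := by
  have : IsManifold (𝓡 n) 1 M := IsManifold.of_le (n := 2) (by norm_num)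
  obtain ⟨T, hT⟩ := isInvertible_mfderivWithin_extChartAt_symm (I := 𝓡 n) hx
  refine ⟨T.toLinearEquiv, fun g hg v => ?_⟩
  have h1 := mdifferentiableWithinAt_extChartAt_symm (I := 𝓡 n) hx
  simp only [modelWithCornersSelf_coe, Set.range_id, mdifferentiableWithinAt_univ] at h1
  simp only [modelWithCornersSelf_coe, Set.range_id, mfderivWithin_univ] at hT
  have h2 := mfderiv_comp_apply x hg h1 v
  rw [mfderiv_eq_fderiv, ← hT] at h2
  exact h2

variable {ψ : M → EuclideanSpace ℝ (Fin (n + 1))}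
  {η : M → sphere (0 : EuclideanSpace ℝ (Fin (n + 1))) 1}

theorem contDiffAt_comp_extChartAt_symm {F : Type*} [NormedAddCommGroup F] [NormedSpace ℝ F]
    {g : M → F} {k : ℕ∞ω} (hk : k ≤ 2) (hg : ContMDiff (𝓡 n) 𝓘(ℝ, F) k g) (p : M)
    {x : EuclideanSpace ℝ (Fin n)} (hx : x ∈ (extChartAt (𝓡 n) p).target) :
    ContDiffAt ℝ k (g ∘ (extChartAt (𝓡 n) p).symm) x := by
  have : IsManifold (𝓡 n) k M := IsManifold.of_le (n := 2) hk
  have h1 : ContMDiffAt 𝓘(ℝ, EuclideanSpace ℝ (Fin n)) (𝓡 n) k (extChartAt (𝓡 n) p).symm x :=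
    (contMDiffOn_extChartAt_symm p).contMDiffAt ((isOpen_extChartAt_target p).mem_nhds hx)
  exact (hg.contMDiffAt.comp x h1).contDiffAt

/-! ### Mean curvature and extrema of height functions -/

namespace IsOrientedHypersurface

variable (h : IsOrientedHypersurface ψ η)

include h

theorem injective_fderiv (p : M) {x : EuclideanSpace ℝ (Fin n)}
    (hx : x ∈ (extChartAt (𝓡 n) p).target) :
    Function.Injective (fderiv ℝ (ψ ∘ (extChartAt (𝓡 n) p).symm) x) := by
  obtain ⟨T, hT⟩ := exists_fderiv_comp_extChartAt_symm_eq p hx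
  intro v w hvw
  rw [hT ψ (h.contMDiff.contMDiffAt.mdifferentiableAt (by simp)),
    hT ψ (h.contMDiff.contMDiffAt.mdifferentiableAt (by simp))] at hvw
  exact T.injective (h.injective_mvfderiv _ hvw)

theorem inner_fderiv_eq_zero (p : M) {x : EuclideanSpace ℝ (Fin n)}
    (hx : x ∈ (extChartAt (𝓡 n) p).target) (v : EuclideanSpace ℝ (Fin n)) :
    inner ℝ (fderiv ℝ (ψ ∘ (extChartAt (𝓡 n) p).symm) x v)
      (η ((extChartAt (𝓡 n) p).symm x) : EuclideanSpace ℝ (Fin (n + 1))) = 0 := by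
  obtain ⟨T, hT⟩ := exists_fderiv_comp_extChartAt_symm_eq p hx
  rw [hT ψ (h.contMDiff.contMDiffAt.mdifferentiableAt (by simp))]
  exact h.normal_orthogonal _ _

theorem eventually_inner_fderiv_eq_zero (p : M) {x : EuclideanSpace ℝ (Fin n)}
    (hx : x ∈ (extChartAt (𝓡 n) p).target) :
    ∀ᶠ y in 𝓝 x, ∀ v, inner ℝ (fderiv ℝ (ψ ∘ (extChartAt (𝓡 n) p).symm) y v)
      (η ((extChartAt (𝓡 n) p).symm y) : EuclideanSpace ℝ (Fin (n + 1))) = 0 := by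
  filter_upwards [(isOpen_extChartAt_target p).mem_nhds hx] with y hy
  exact h.inner_fderiv_eq_zero p hy

/-- Since `η` has unit length, its differential is orthogonal to `η`, hence lies in the range of the
differential of `ψ`, where the left inverse is a true inverse. -/
theorem mvfderiv_shapeOperator (p : M) {x : EuclideanSpace ℝ (Fin n)}
    (hx : x ∈ (extChartAt (𝓡 n) p).target)
    (v : TangentSpace (𝓡 n) ((extChartAt (𝓡 n) p).symm x)) :
    mvfderiv (𝓡 n) ψ ((extChartAt (𝓡 n) p).symm x) (shapeOperator ψ η _ v) =
      -mvfderiv (𝓡 n) (fun q => (η q : EuclideanSpace ℝ (Fin (n + 1)))) _ v := by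
  obtain ⟨T, hT⟩ := exists_fderiv_comp_extChartAt_symm_eq p hx
  have hη : DifferentiableAt ℝ ((fun q => (η q : EuclideanSpace ℝ (Fin (n + 1)))) ∘
      (extChartAt (𝓡 n) p).symm) x :=
    (contDiffAt_comp_extChartAt_symm (by norm_num) h.contMDiff_normal p hx).differentiableAt
      (by simp)
  have h1 := fderiv_inner_self_eq_zero hη (.of_forall fun y => norm_eq_of_mem_sphere _) (T.symm v)
  obtain ⟨w, hw⟩ := exists_apply_eq_of_inner_eq_zero (by simp) (h.injective_fderiv p hx)
    (norm_eq_of_mem_sphere _) (h.inner_fderiv_eq_zero p hx) h1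
  rw [hT ψ (h.contMDiff.contMDiffAt.mdifferentiableAt (by simp)),
    hT _ (h.contMDiff_normal.contMDiffAt.mdifferentiableAt (by simp)), T.apply_symm_apply] at hw
  have h2 : LinearMap.ker (mvfderiv (𝓡 n) ψ ((extChartAt (𝓡 n) p).symm x)).toLinearMap = ⊥ :=
    LinearMap.ker_eq_bot.2 (h.injective_mvfderiv _)
  have h3 : shapeOperator ψ η _ v = -T w := by
    unfold shapeOperator
    rw [LinearMap.neg_apply, LinearMap.comp_apply]
    have := LinearMap.leftInverse_apply_of_inj h2 (T w)
    rw [← this]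
    congr 2
    exact hw.symm
  rw [h3, map_neg, hw]

/-- The mean curvature in a chart, as the trace of the second fundamental form. -/
theorem mul_meanCurvature_eq_sum (hn : n ≠ 0) (p : M) {x : EuclideanSpace ℝ (Fin n)}
    (hx : x ∈ (extChartAt (𝓡 n) p).target) {ι : Type*} [Fintype ι]
    {b : Basis ι ℝ (EuclideanSpace ℝ (Fin n))}
    (hb : Orthonormal ℝ fun i => fderiv ℝ (ψ ∘ (extChartAt (𝓡 n) p).symm) x (b i)) :
    n * meanCurvature ψ η ((extChartAt (𝓡 n) p).symm x) =
      ∑ i, inner ℝ (η ((extChartAt (𝓡 n) p).symm x) : EuclideanSpace ℝ (Fin (n + 1)))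
        (fderiv ℝ (fderiv ℝ (ψ ∘ (extChartAt (𝓡 n) p).symm)) x (b i) (b i)) := by
  obtain ⟨T, hT⟩ := exists_fderiv_comp_extChartAt_symm_eq p hx
  have hψ := contDiffAt_comp_extChartAt_symm le_rfl h.contMDiff p hx
  have hη : DifferentiableAt ℝ ((fun q => (η q : EuclideanSpace ℝ (Fin (n + 1)))) ∘
      (extChartAt (𝓡 n) p).symm) x :=
    (contDiffAt_comp_extChartAt_symm (by norm_num) h.contMDiff_normal p hx).differentiableAt
      (by simp)
  have h1 := trace_eq_sum_inner_fderiv_fderiv hψ hη (h.eventually_inner_fderiv_eq_zero p hx)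
    (S := T.symm.conj (shapeOperator ψ η ((extChartAt (𝓡 n) p).symm x))) (fun v => by
      rw [hT ψ (h.contMDiff.contMDiffAt.mdifferentiableAt (by simp)),
        hT _ (h.contMDiff_normal.contMDiffAt.mdifferentiableAt (by simp)), LinearEquiv.conj_apply]
      simp only [LinearMap.comp_apply, LinearEquiv.coe_coe, LinearEquiv.symm_symm,
        LinearEquiv.apply_symm_apply]
      exact h.mvfderiv_shapeOperator p hx _) hb
  rw [LinearMap.trace_conj'] at h1
  rw [meanCurvature, mul_div_cancel₀ _ (Nat.cast_ne_zero.2 hn), h1]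
  rfl

theorem contDiffAt_height (p : M) {x : EuclideanSpace ℝ (Fin n)}
    (hx : x ∈ (extChartAt (𝓡 n) p).target) (a : EuclideanSpace ℝ (Fin (n + 1))) :
    ContDiffAt ℝ 2 (fun y => inner ℝ a ((ψ ∘ (extChartAt (𝓡 n) p).symm) y)) x :=
  contDiffAt_const.inner ℝ (contDiffAt_comp_extChartAt_symm le_rfl h.contMDiff p hx)

/-- At a critical point of the height `a` is orthogonal to the tangent space, so the tangential part
of `a` is orthogonal to both `a` and the normal, and hence to itself. -/
theorem eq_inner_smul_normal_of_isLocalExtr {a : EuclideanSpace ℝ (Fin (n + 1))} {p : M}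
    (hext : IsLocalExtr (fun q => inner ℝ a (ψ q)) p) :
    a = inner ℝ a (η p : EuclideanSpace ℝ (Fin (n + 1))) •
      (η p : EuclideanSpace ℝ (Fin (n + 1))) := by
  have hp := mem_extChartAt_target (I := 𝓡 n) p
  have hψ := contDiffAt_comp_extChartAt_symm le_rfl h.contMDiff p hp
  have hcrit := (hext.comp_extChartAt_symm (n := n) (f := inner ℝ a)).fderiv_eq_zero
  rw [fderiv_inner_const_left (hψ.differentiableAt (by simp))] at hcrit
  have horth := h.inner_fderiv_eq_zero p hp
  rw [extChartAt_to_inv] at horth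
  have hη : ‖(η p : EuclideanSpace ℝ (Fin (n + 1)))‖ = 1 := norm_eq_of_mem_sphere _
  set ν : EuclideanSpace ℝ (Fin (n + 1)) := (η p : EuclideanSpace ℝ (Fin (n + 1)))
  have htan : inner ℝ (a - inner ℝ a ν • ν) ν = (0 : ℝ) := by
    rw [inner_sub_left, real_inner_smul_left, real_inner_self_eq_norm_sq, hη]; ring
  obtain ⟨v, hv⟩ := exists_apply_eq_of_inner_eq_zero (by simp) (h.injective_fderiv p hp) hη horth
    htan
  have h1 : inner ℝ a (a - inner ℝ a ν • ν) = (0 : ℝ) := by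
    rw [← hv]; exact DFunLike.congr_fun hcrit v
  refine sub_eq_zero.1 (inner_self_eq_zero (𝕜 := ℝ).1 ?_)
  rw [inner_sub_left, real_inner_smul_left, h1, (real_inner_comm _ _).trans htan]
  ring

theorem normal_eq_or_eq_neg_of_isLocalExtr
    {a : sphere (0 : EuclideanSpace ℝ (Fin (n + 1))) 1} {p : M}
    (hext : IsLocalExtr (fun q => inner ℝ (a : EuclideanSpace ℝ (Fin (n + 1))) (ψ q)) p) :
    η p = a ∨ η p = -a := by
  have h1 := h.eq_inner_smul_normal_of_isLocalExtr hext
  have h2 := congrArg norm h1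
  rw [norm_smul, norm_eq_of_mem_sphere, norm_eq_of_mem_sphere, mul_one, Real.norm_eq_abs] at h2
  rcases eq_or_eq_neg_of_abs_eq h2.symm with h3 | h3
  · left
    rw [h3, one_smul] at h1
    exact Subtype.ext h1.symm
  · right
    rw [h3, neg_one_smul] at h1
    refine Subtype.ext ?_
    rw [coe_neg_sphere, h1, neg_neg]

theorem mul_meanCurvature_eq_sum_height (hn : n ≠ 0) (p : M) :
    ∃ e : Fin (finrank ℝ (EuclideanSpace ℝ (Fin n))) → EuclideanSpace ℝ (Fin n), n * meanCurvature ψ η p =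
      ∑ i, fderiv ℝ (fderiv ℝ fun y => inner ℝ (η p : EuclideanSpace ℝ (Fin (n + 1)))
        ((ψ ∘ (extChartAt (𝓡 n) p).symm) y)) (extChartAt (𝓡 n) p p) (e i) (e i) := by
  have hp := mem_extChartAt_target (I := 𝓡 n) p
  obtain ⟨b, hb⟩ := exists_basis_orthonormal_comp _ (h.injective_fderiv p hp)
  have hsum := h.mul_meanCurvature_eq_sum hn p hp hb
  rw [extChartAt_to_inv] at hsum
  refine ⟨b, hsum.trans (Finset.sum_congr rfl fun i _ => ?_)⟩
  rw [fderiv_fderiv_inner_const_left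
    (contDiffAt_comp_extChartAt_symm le_rfl h.contMDiff p hp)]

theorem meanCurvature_nonpos_of_isLocalMax (hn : n ≠ 0) {p : M}
    (hmax : IsLocalMax (fun q => inner ℝ (η p : EuclideanSpace ℝ (Fin (n + 1))) (ψ q)) p) :
    meanCurvature ψ η p ≤ 0 := by
  obtain ⟨e, he⟩ := h.mul_meanCurvature_eq_sum_height hn p
  refine nonpos_of_mul_nonpos_right (he.trans_le (Finset.sum_nonpos fun i _ => ?_))
    (Nat.cast_pos.2 (Nat.pos_of_ne_zero hn))
  exact (hmax.comp_extChartAt_symm (n := n)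
    (f := inner ℝ (η p : EuclideanSpace ℝ (Fin (n + 1))))).fderiv_fderiv_apply_self_nonpos
    (h.contDiffAt_height p (mem_extChartAt_target p) _) _

theorem meanCurvature_nonneg_of_isLocalMin (hn : n ≠ 0) {p : M}
    (hmin : IsLocalMin (fun q => inner ℝ (η p : EuclideanSpace ℝ (Fin (n + 1))) (ψ q)) p) :
    0 ≤ meanCurvature ψ η p := by
  obtain ⟨e, he⟩ := h.mul_meanCurvature_eq_sum_height hn p
  refine nonneg_of_mul_nonneg_right ((Finset.sum_nonneg fun i _ => ?_).trans_eq he.symm)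
    (Nat.cast_pos.2 (Nat.pos_of_ne_zero hn))
  exact (hmin.comp_extChartAt_symm (n := n)
    (f := inner ℝ (η p : EuclideanSpace ℝ (Fin (n + 1))))).fderiv_fderiv_apply_self_nonneg
    (h.contDiffAt_height p (mem_extChartAt_target p) _) _

end IsOrientedHypersurface

/-! ### Tangency with a hyperplane and its global consequence -/

namespace IsPrescribedMeanCurvatureHypersurface

variable {𝓗 : sphere (0 : EuclideanSpace ℝ (Fin (n + 1))) 1 → ℝ}
  (h : IsPrescribedMeanCurvatureHypersurface 𝓗 ψ η)

include h

/-- Tangency principle: where the height in a direction `a` with `𝓗 a = 0` has a local extremum and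
the normal is `a`, the hypersurface is locally contained in its tangent hyperplane. -/
theorem eventually_height_eq_of_isLocalExtr (hn : n ≠ 0)
    {a : sphere (0 : EuclideanSpace ℝ (Fin (n + 1))) 1}
    (h𝓗 : ContMDiffAt (𝓡 n) 𝓘(ℝ, ℝ) 1 𝓗 a) (ha : 𝓗 a = 0) {p : M} (hp : η p = a)
    (hext : IsLocalExtr (fun q => inner ℝ (a : EuclideanSpace ℝ (Fin (n + 1))) (ψ q)) p) :
    ∀ᶠ q in 𝓝 p, inner ℝ (a : EuclideanSpace ℝ (Fin (n + 1))) (ψ q) =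
      (inner ℝ (a : EuclideanSpace ℝ (Fin (n + 1))) (ψ p) : ℝ) := by
  have H := h.toIsOrientedHypersurface
  obtain ⟨K, hK, hKa⟩ := exists_eventually_abs_le_of_contMDiffAt_sphere h𝓗 ha
  have ht := mem_extChartAt_target (I := 𝓡 n) p
  have htn := (isOpen_extChartAt_target (I := 𝓡 n) p).mem_nhds ht
  have hη := contDiffAt_comp_extChartAt_symm (by norm_num) H.contMDiff_normal p ht
  have hηc : Tendsto η (𝓝 p) (𝓝 a) := by
    rw [← hp]
    exact (continuous_induced_rng.2 H.contMDiff_normal.continuous).continuousAt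
  have hloc := (hext.comp_extChartAt_symm (n := n)
    (f := inner ℝ (a : EuclideanSpace ℝ (Fin (n + 1))))).eventually_inner_eq_of_sum_inner_fderiv_le
    (η := (fun q => (η q : EuclideanSpace ℝ (Fin (n + 1)))) ∘ (extChartAt (𝓡 n) p).symm)
    (K := n * K) (by simp) (by positivity)
    (contDiffAt_comp_extChartAt_symm le_rfl H.contMDiff p ht) hη.continuousAt
    (H.injective_fderiv p ht) (.of_forall fun y => norm_eq_of_mem_sphere _)
    (by simp [hp]) (H.eventually_inner_fderiv_eq_zero p ht) (by
      filter_upwards [htn, (tendsto_extChartAt_symm_nhds p).eventually (hηc.eventually hKa)] with y hy hyK b hb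
      have h1 := H.mul_meanCurvature_eq_sum hn p hy hb
      simp only [Function.comp_apply]
      rw [← h1, h.meanCurvature_eq, abs_mul, Nat.abs_cast, mul_assoc]
      exact mul_le_mul_of_nonneg_left hyK (Nat.cast_nonneg n))
  filter_upwards [(continuousAt_extChartAt (I := 𝓡 n) p).eventually hloc,
    extChartAt_source_mem_nhds (I := 𝓡 n) p] with q hq hqs
  simp only [Function.comp_apply, (extChartAt (𝓡 n) p).left_inv hqs, extChartAt_to_inv] at hq
  exact hq

theorem false_of_isExtrOn_of_normal_eq [CompactSpace M] (hn : n ≠ 0)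
    {a : sphere (0 : EuclideanSpace ℝ (Fin (n + 1))) 1}
    (h𝓗 : ContMDiffAt (𝓡 n) 𝓘(ℝ, ℝ) 1 𝓗 a) (ha : 𝓗 a = 0) {p : M} (hp : η p = a)
    (hext : IsExtrOn (fun q => inner ℝ (a : EuclideanSpace ℝ (Fin (n + 1))) (ψ q)) Set.univ p) :
    False := by
  have H := h.toIsOrientedHypersurface
  have hψc : Continuous ψ := H.contMDiff.continuous
  have hηc : Continuous η := continuous_induced_rng.2 H.contMDiff_normal.continuous
  set f : M → ℝ := fun q => inner ℝ (a : EuclideanSpace ℝ (Fin (n + 1))) (ψ q) with hf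
  have hfc : Continuous f := continuous_const.inner hψc
  set C : Set M := {q | f q = f p ∧ η q = a} with hC
  have hclosed : IsClosed C :=
    (isClosed_eq hfc continuous_const).inter (isClosed_eq hηc continuous_const)
  have hopen : IsOpen C := by
    refine isOpen_iff_eventually.2 fun q hq => ?_
    have hextq : IsLocalExtr f q := by
      refine hext.imp (fun h' => ?_) (fun h' => ?_)
      · exact .of_forall fun z => hq.1 ▸ h' (Set.mem_univ z)
      · exact .of_forall fun z => hq.1 ▸ h' (Set.mem_univ z)
    have hconst := h.eventually_height_eq_of_isLocalExtr hn h𝓗 ha hq.2 hextq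
    -- Where the height is locally constant every point is a local extremum, so the normal is `a` or
    -- `-a`; continuity excludes `-a` near `q`.
    have hne : ∀ᶠ z in 𝓝 q, η z ≠ -a := by
      refine hηc.continuousAt.eventually_ne ?_
      rw [hq.2]
      exact ne_neg_of_mem_unit_sphere ℝ a
    filter_upwards [hconst.eventually_nhds, hne] with z hz hza
    refine ⟨hz.self_of_nhds.trans hq.1, ?_⟩
    refine (H.normal_eq_or_eq_neg_of_isLocalExtr (a := a) (p := z) (Or.inl ?_)).resolve_right hza
    filter_upwards [hz] with z' hz'
    exact (hz'.trans hz.self_of_nhds.symm).ge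
  obtain ⟨e, he0, hea⟩ : ∃ e : EuclideanSpace ℝ (Fin (n + 1)), e ≠ 0 ∧
      inner ℝ e (a : EuclideanSpace ℝ (Fin (n + 1))) = (0 : ℝ) := by
    have hfin :=
      (Submodule.span ℝ {(a : EuclideanSpace ℝ (Fin (n + 1)))}).finrank_add_finrank_orthogonal
    rw [finrank_span_singleton (ne_zero_of_mem_unit_sphere a), finrank_euclideanSpace_fin] at hfin
    have : Nontrivial (Submodule.span ℝ {(a : EuclideanSpace ℝ (Fin (n + 1)))})ᗮ :=
      nontrivial_of_finrank_pos (R := ℝ) (by omega)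
    obtain ⟨e, he⟩ := exists_ne (0 : (Submodule.span ℝ {(a : EuclideanSpace ℝ (Fin (n + 1)))})ᗮ)
    exact ⟨e, by simpa using he, Submodule.mem_orthogonal_singleton_iff_inner_left.1 e.2⟩
  -- Because `C` is open, a maximum over `C` is a local maximum on `M`; this forces `e` to be a
  -- multiple of `a`, while `e` is nonzero and orthogonal to `a`.
  obtain ⟨q, hq, hqmax⟩ := hclosed.isCompact.exists_isMaxOn ⟨p, rfl, hp⟩
    (f := fun q => inner ℝ e (ψ q)) (continuous_const.inner hψc).continuousOn
  have hqe := H.eq_inner_smul_normal_of_isLocalExtr (Or.inr (hqmax.isLocalMax (hopen.mem_nhds hq)))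
  rw [hq.2, hea, zero_smul] at hqe
  exact he0 hqe

end IsPrescribedMeanCurvatureHypersurface

end Charts

/-! ### The nonexistence theorem -/

theorem proposition2p5 (n : ℕ) (hn : 1 ≤ n)
    (𝓗 : Metric.sphere (0 : EuclideanSpace ℝ (Fin (n + 1))) 1 → ℝ)
    (h𝓗 : ContMDiff (𝓡 n) 𝓘(ℝ, ℝ) 1 𝓗)
    (hzero : ∃ x₀, 𝓗 x₀ = 0)
    (M : Type*) [TopologicalSpace M] [T2Space M] [CompactSpace M] [Nonempty M]
    [ChartedSpace (EuclideanSpace ℝ (Fin n)) M] [IsManifold (𝓡 n) 2 M] :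
    ¬ ∃ (ψ : M → EuclideanSpace ℝ (Fin (n + 1)))
        (η : M → Metric.sphere (0 : EuclideanSpace ℝ (Fin (n + 1))) 1),
      IsPrescribedMeanCurvatureHypersurface 𝓗 ψ η := by
  rintro ⟨ψ, η, h⟩
  obtain ⟨a, ha⟩ := hzero
  have hn0 : n ≠ 0 := by omega
  have H := h.toIsOrientedHypersurface
  have hfc : Continuous fun q => inner ℝ (a : EuclideanSpace ℝ (Fin (n + 1))) (ψ q) :=
    continuous_const.inner H.contMDiff.continuous
  obtain ⟨p, -, hp⟩ := isCompact_univ.exists_isMaxOn (Set.univ_nonempty (α := M)) hfc.continuousOn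
  obtain ⟨q, -, hq⟩ := isCompact_univ.exists_isMinOn (Set.univ_nonempty (α := M)) hfc.continuousOn
  rcases H.normal_eq_or_eq_neg_of_isLocalExtr (Or.inr (hp.isLocalMax univ_mem)) with hpa | hpa
  · exact h.false_of_isExtrOn_of_normal_eq hn0 h𝓗.contMDiffAt ha hpa (Or.inr hp)
  rcases H.normal_eq_or_eq_neg_of_isLocalExtr (Or.inl (hq.isLocalMin univ_mem)) with hqa | hqa
  · exact h.false_of_isExtrOn_of_normal_eq hn0 h𝓗.contMDiffAt ha hqa (Or.inl hq)
  -- The normal is now `-a` at both extrema. In the direction `-a` the maximum and the minimum trade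
  -- places, so the curvature signs at `p` and `q` are opposite and give `𝓗 (-a) = 0`.
  have hp' : IsMinOn (fun q => inner ℝ ((-a : sphere (0 : EuclideanSpace ℝ (Fin (n + 1))) 1) :
      EuclideanSpace ℝ (Fin (n + 1))) (ψ q)) Set.univ p := by
    simpa only [coe_neg_sphere, inner_neg_left] using hp.neg
  have hq' : IsMaxOn (fun q => inner ℝ ((-a : sphere (0 : EuclideanSpace ℝ (Fin (n + 1))) 1) :
      EuclideanSpace ℝ (Fin (n + 1))) (ψ q)) Set.univ q := by
    simpa only [coe_neg_sphere, inner_neg_left] using hq.neg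
  have h1 := H.meanCurvature_nonneg_of_isLocalMin hn0 (p := p)
    (by rw [hpa]; exact hp'.isLocalMin univ_mem)
  have h2 := H.meanCurvature_nonpos_of_isLocalMax hn0 (p := q)
    (by rw [hqa]; exact hq'.isLocalMax univ_mem)
  rw [h.meanCurvature_eq, Function.comp_apply, hpa] at h1
  rw [h.meanCurvature_eq, Function.comp_apply, hqa] at h2
  exact h.false_of_isExtrOn_of_normal_eq hn0 h𝓗.contMDiffAt (le_antisymm h2 h1) hpa (Or.inl hp')
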